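/- Let $\Bbbk$ be an infinite field and let $A\subset\mathbb{Z}^d\smallsetminus\{0\}$ be a finite set whose cone $\mathbb{R}_{\ge 0}A$ contains no line. For $F\subseteq A$ write $\mathbb{N}F$ and $\mathbb{Z}F$ for the monoid and the group generated by $F$. Let $\Bbbk[\mathbb{N}A]$ be the semigroup ring with monomials $t^a$, $a\in\mathbb{N}A$; a monomial ideal is an ideal generated by monomials. For $b,x\in\mathbb{N}A$, $b$ divides $x$ if $x-b\in\mathbb{N}A$. A subset $F\subseteq A$ is a face of $A$ if $\mathbb{R}_{\ge0}F$ is a face of $\mathbb{R}_{\ge0}A$ and $\mathbb{R}_{\ge0}F\cap A=F$ ($F=\varnothing$ and $F=A$ are allowed). For a face $F$ put $\mathfrak{p}_F=\langle t^a\mid a\in\mathbb{N}A\smallsetminus\mathbb{N}F\rangle$. A pair $(a,F)$ consists of $a\in\mathbb{N}A$ and a face $F$ of $A$; it is said to belong to $F$. Two pairs $(a,F),(b,F)$ belonging to the same face overlap if $a-b\in\mathbb{Z}F$; this is an equivalence relation, whose classes are called overlap classes. A pair $(a,F)$ divides $(b,G)$ if $a+c+\mathbb{N}F\subseteq b+\mathbb{N}G$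 for some $c\in\mathbb{N}A$; this induces a partial order on overlap classes. For a monomial ideal $I$, the standard monomials are the monomials $t^a\notin I$. A pair $(a,F)$ is proper for $I$ if $t^x\notin I$ for all $x\in a+\mathbb{N}F$, and is a standard pair of $I$ if it is proper and $a+\mathbb{N}F$ is maximal under inclusion among the sets $b+\mathbb{N}G$ of proper pairs $(b,G)$ of $I$. Theorem. Let $I$ be a monomial ideal in $\Bbbk[\mathbb{N}A]$ and let $\mathscr{S}$ be the set of faces of $A$ to which some standard pair of $I$ belongs. For every $F\in\mathscr{S}$ there is a (unique) monomial ideal $C_F$ whose standard monomials are exactly the $t^b$ such that $b\in\mathbb{N}A$ divides some element of $a+\mathbb{N}F$ for some standard pair $(a,F)$ of $I$ belonging to $F$ whose overlap class is maximal, with respect to divisibility, among the overlap classes of standard pairs of $I$. The ideal $C_F$ is $\mathfrak{p}_F$-primary, the set $\mathscr{S}$ is finite, and $$I=\bigcap_{F\in\mathscr{S}}C_F$$ is an irredundant primary decomposition of $I$: no $C_F$ can be omitted, and the primes $\mathfrak{p}_F$, $F\in\mathscr{S}$, are pairwise distinct (for $I=\Bbbk[\mathbb{N}A]$ the set $\mathscr{S}$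 is empty and the empty intersection is the whole ring). Consequently, for every face $F$ of $A$: 1. $\mathfrak{p}_F$ is an associated prime of $I$ (that is, of the module $\Bbbk[\mathbb{N}A]/I$) if and only if $I$ has a standard pair that belongs to $F$; 2. if $I\neq\Bbbk[\mathbb{N}A]$, then $I$ is $\mathfrak{p}_F$-primary if and only if all standard pairs of $I$ belong to $F$. -/

import Mathlib

noncomputable section

namespace AffineSemigroup

variable {d : ℕ}

/-- The monoid `ℕF` of nonnegative integer combinations of the elements of `F`. -/
abbrev natSpan (F : Finset (Fin d → ℤ)) : AddSubmonoid (Fin d → ℤ) :=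
  AddSubmonoid.closure (F : Set (Fin d → ℤ))

/-- The group `ℤF` of integer combinations of the elements of `F`. -/
abbrev intSpan (F : Finset (Fin d → ℤ)) : AddSubgroup (Fin d → ℤ) :=
  AddSubgroup.closure (F : Set (Fin d → ℤ))

/-- A lattice point regarded as a point of `ℝ^d`. -/
def toReal (a : Fin d → ℤ) : Fin d → ℝ := fun i => (a i : ℝ)

/-- The cone `ℝ_{≥0} F` of nonnegative real combinations of the elements of `F`. -/
def realCone (F : Finset (Fin d → ℤ)) : PointedCone ℝ (Fin d → ℝ) :=
  PointedCone.hull ℝ (toReal '' (F : Set (Fin d → ℤ)))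

/-- The cone `ℝ_{≥0} A` contains no line. -/
def IsStronglyConvex (A : Finset (Fin d → ℤ)) : Prop :=
  ∀ x ∈ realCone A, -x ∈ realCone A → x = 0

/-- `F ⊆ A` is a face of `A`: the cone over `F` is a face of the cone over `A`,
and the points of `A` in the cone over `F` are exactly those of `F`. -/
structure IsFace (A F : Finset (Fin d → ℤ)) : Prop where
  subset : F ⊆ A
  isFaceOf : (realCone F).IsFaceOf (realCone A)
  mem_iff : ∀ a ∈ A, toReal a ∈ realCone F ↔ a ∈ F

/-- A pair `(a, F)` of `A`: an element `a` of `ℕA` and a face `F` of `A`. -/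
structure Pair (A : Finset (Fin d → ℤ)) where
  base : Fin d → ℤ
  base_mem : base ∈ natSpan A
  face : Finset (Fin d → ℤ)
  isFace : IsFace A face

namespace Pair

variable {A : Finset (Fin d → ℤ)}

/-- The set `a + ℕF` of a pair `(a, F)`. -/
def coset (p : Pair A) : Set (Fin d → ℤ) := {x | ∃ f ∈ natSpan p.face, x = p.base + f}

/-- `(a, F) ≺ (b, G)`: `a + ℕF ⊆ b + ℕG`. -/
def Prec (p q : Pair A) : Prop := p.coset ⊆ q.coset

/-- `(a, F)` and `(b, G)` overlap: `F = G` and `a - b ∈ ℤF`. -/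
def Overlap (p q : Pair A) : Prop := p.face = q.face ∧ p.base - q.base ∈ intSpan p.face

/-- `(a, F)` divides `(b, G)`: `a + c + ℕF ⊆ b + ℕG` for some `c ∈ ℕA`. -/
def Divides (p q : Pair A) : Prop :=
  ∃ c ∈ natSpan A, ∀ f ∈ natSpan p.face, p.base + c + f ∈ q.coset

end Pair

variable (𝕜 : Type*) [Field 𝕜] (A : Finset (Fin d → ℤ))

/-- The affine semigroup ring `𝕜[ℕA]`. -/
abbrev SemigroupRing : Type _ := AddMonoidAlgebra 𝕜 (natSpan A)

variable {A}

/-- The monomial `t^b` of `𝕜[ℕA]`. -/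
def monomial (b : natSpan A) : SemigroupRing 𝕜 A := AddMonoidAlgebra.single b 1

variable {𝕜}

/-- A monomial ideal of `𝕜[ℕA]`: an ideal generated by monomials. -/
def IsMonomialIdeal (I : Ideal (SemigroupRing 𝕜 A)) : Prop :=
  ∃ s : Set (natSpan A), I = Ideal.span (monomial 𝕜 '' s)

/-- The set of (exponents of) standard monomials of `I`. -/
def stdMonomials (I : Ideal (SemigroupRing 𝕜 A)) : Set (Fin d → ℤ) :=
  {b | ∃ hb : b ∈ natSpan A, monomial 𝕜 ⟨b, hb⟩ ∉ I}

/-- `(a, F)` is a proper pair of `I`: all monomials of `a + ℕF` are standard. -/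
def IsProperPair (I : Ideal (SemigroupRing 𝕜 A)) (p : Pair A) : Prop :=
  p.coset ⊆ stdMonomials I

/-- A standard pair of `I`: a proper pair of `I` which is maximal for `≺`. -/
def IsStandardPair (I : Ideal (SemigroupRing 𝕜 A)) (p : Pair A) : Prop :=
  IsProperPair I p ∧ ∀ q : Pair A, IsProperPair I q → p.Prec q → q.Prec p

/-- `p` is a standard pair of `I` whose overlap class is maximal, with respect to divisibility,
among the overlap classes of standard pairs of `I`. -/
def IsMaximalStandardPair (I : Ideal (SemigroupRing 𝕜 A)) (p : Pair A) : Prop :=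
  IsStandardPair I p ∧ ∀ q : Pair A, IsStandardPair I q → p.Divides q → q.Overlap p

/-- The faces of `A` to which some standard pair of `I` belongs. -/
def standardFaces (I : Ideal (SemigroupRing 𝕜 A)) : Set (Finset (Fin d → ℤ)) :=
  {F | ∃ p : Pair A, IsStandardPair I p ∧ p.face = F}

/-- The `b ∈ ℕA` which divide some element of `a + ℕF`, for some standard pair `(a, F)` of `I`
belonging to `F` whose overlap class is maximal with respect to divisibility. -/
def componentStdMonomials (I : Ideal (SemigroupRing 𝕜 A)) (F : Finset (Fin d → ℤ)) :
    Set (Fin d → ℤ) :=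
  {b | b ∈ natSpan A ∧ ∃ p : Pair A, IsMaximalStandardPair I p ∧ p.face = F ∧
    ∃ x ∈ p.coset, x - b ∈ natSpan A}

/-- The monomial ideal `C_F`, generated by the monomials outside `componentStdMonomials I F`. -/
def component (I : Ideal (SemigroupRing 𝕜 A)) (F : Finset (Fin d → ℤ)) :
    Ideal (SemigroupRing 𝕜 A) :=
  Ideal.span (monomial 𝕜 '' {b | (b : Fin d → ℤ) ∉ componentStdMonomials I F})

variable (𝕜 A)

/-- The ideal `𝔭_F` generated by the monomials `t^a` with `a ∈ ℕA \ ℕF`. -/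
def facePrime (F : Finset (Fin d → ℤ)) : Ideal (SemigroupRing 𝕜 A) :=
  Ideal.span (monomial 𝕜 '' {a | (a : Fin d → ℤ) ∉ natSpan F})

variable {𝕜 A}

/-- `J` is `𝔭`-primary: `J` is a primary ideal with radical `𝔭`. -/
def IsPrimaryTo (J p : Ideal (SemigroupRing 𝕜 A)) : Prop := J.IsPrimary ∧ J.radical = p

end AffineSemigroup

end

open AffineSemigroup

/-! ### Faces of the cone and faces of the monoid -/

noncomputable section

namespace AffineSemigroup

variable {d : ℕ}

/-! A monomial ideal is determined by its standard monomials, a set closed under divisors, so the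
decomposition is a statement about such subsets of ℕA. Attach to a pair the set of divisors of its
coset (`Pair.divisors`): between pairs of one face, divisibility becomes inclusion and overlap
becomes equality of these sets. By Dickson's lemma every standard monomial lies in a standard pair
(`IsProperPair.exists_isStandardPair`), and each face carries finitely many overlap classes of
standard pairs (`finite_divisors_image`), so every standard pair divides a maximal one of the same
face. Hence the standard monomials of `I` are the union of those of the C_F, which is the
intersection formula.

C_F is primary because its standard monomials are stable under ℕF, so nonzero elements of 𝕜[ℕF] are
nonzerodivisors modulo C_F, while every monomial outside 𝕜[ℕF] is nilpotent modulo C_F.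

Irredundancy and the associated primes come from a monomial t^m that lies in every component except
C_F and satisfies (I : t^m) = 𝔭_F (`exists_monomial_colon`).

Faces are defined by real cones, but the arguments use the face property of the monoid ℕF in ℕA.
Passing from monoid to cone requires turning real linear relations into integral ones. -/

/-- Finitely many positive reals are positive under a common `ℚ`-linear functional `ℝ → ℚ`. -/
theorem exists_ratLinearMap_pos (S : Finset ℝ) (hS : ∀ s ∈ S, 0 < s) :
    ∃ φ : ℝ →ₗ[ℚ] ℚ, ∀ s ∈ S, 0 < φ s := by
  -- Vary the images `e` of a Hamel basis. Positivity on `S` is an open condition in the product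
  -- topology, involving finitely many coordinates, and `e = B` satisfies it. Rational vectors are
  -- dense, so some rational `e` does too.
  let B := Module.Basis.ofVectorSpace ℚ ℝ
  have hopen : IsOpen {e : Module.Basis.ofVectorSpaceIndex ℚ ℝ → ℝ |
      ∀ s ∈ S, 0 < (B.repr s).sum fun i q => (q : ℝ) * e i} := by
    simp only [Set.ofPred_forall]
    refine isOpen_biInter_finset fun s _ => isOpen_lt continuous_const ?_
    unfold Finsupp.sum
    fun_prop
  have hne : {e : Module.Basis.ofVectorSpaceIndex ℚ ℝ → ℝ |
      ∀ s ∈ S, 0 < (B.repr s).sum fun i q => (q : ℝ) * e i}.Nonempty := by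
    refine ⟨B, fun s hs => ?_⟩
    have h := B.linearCombination_repr s
    rw [Finsupp.linearCombination_apply] at h
    simp only [Rat.smul_def] at h
    rw [h]
    exact hS s hs
  obtain ⟨e, he⟩ := (DenseRange.piMap
    (fun _ : Module.Basis.ofVectorSpaceIndex ℚ ℝ => Rat.denseRange_cast (𝕜 := ℝ))).exists_mem_open
    hopen hne
  refine ⟨B.constr ℚ e, fun s hs => ?_⟩
  have h := he s hs
  rw [Module.Basis.constr_apply]
  simp only [Finsupp.sum, Pi.map_apply] at h ⊢
  exact_mod_cast h

theorem toReal_add (a b : Fin d → ℤ) : toReal (a + b) = toReal a + toReal b := by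
  ext; simp [toReal]

theorem toReal_zero : toReal (0 : Fin d → ℤ) = 0 := by
  ext; simp [toReal]

theorem toReal_mem_realCone {F : Finset (Fin d → ℤ)} {x : Fin d → ℤ} (hx : x ∈ natSpan F) :
    toReal x ∈ realCone F := by
  induction hx using AddSubmonoid.closure_induction with
  | mem x h => exact Submodule.subset_span ⟨x, h, rfl⟩
  | zero => rw [toReal_zero]; exact zero_mem _
  | add x y _ _ hx hy => rw [toReal_add]; exact add_mem hx hy

theorem mem_realCone_iff {F : Finset (Fin d → ℤ)} {x : Fin d → ℝ} :
    x ∈ realCone F ↔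
      ∃ u : (Fin d → ℤ) → ℝ, (∀ c ∈ F, 0 ≤ u c) ∧ x = ∑ c ∈ F, u c • toReal c := by
  classical
  constructor
  · intro hx
    refine Submodule.span_induction (p := fun x _ => ∃ u : (Fin d → ℤ) → ℝ,
      (∀ c ∈ F, 0 ≤ u c) ∧ x = ∑ c ∈ F, u c • toReal c) ?_ ?_ ?_ ?_ hx
    · rintro _ ⟨c, hc, rfl⟩
      refine ⟨fun c' => if c' = c then 1 else 0, fun c' _ => by dsimp only; split_ifs <;> simp, ?_⟩
      have hc' : c ∈ F := hc
      simp [hc']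
    · exact ⟨0, by simp, by simp⟩
    · rintro _ _ _ _ ⟨u, hu, rfl⟩ ⟨v, hv, rfl⟩
      exact ⟨u + v, fun c hc => add_nonneg (hu c hc) (hv c hc),
        by simp [add_smul, Finset.sum_add_distrib]⟩
    · rintro r _ _ ⟨u, hu, rfl⟩
      refine ⟨fun c => r.1 * u c, fun c hc => mul_nonneg r.2 (hu c hc), ?_⟩
      rw [Finset.smul_sum]
      exact Finset.sum_congr rfl fun c _ => by rw [mul_smul]; rfl
  · rintro ⟨u, hu, rfl⟩
    refine sum_mem fun c hc => ?_
    exact PointedCone.smul_mem _ (hu c hc) (Submodule.subset_span ⟨c, hc, rfl⟩)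

/-- A real linear relation among the elements of `A`, nonnegative outside a face of the monoid
`ℕA`, vanishes outside that face. -/
theorem eq_zero_of_sum_smul_toReal_eq_zero {A : Finset (Fin d → ℤ)}
    {P : AddSubmonoid (Fin d → ℤ)}
    (hP : ∀ x ∈ natSpan A, ∀ y ∈ natSpan A, x + y ∈ P → x ∈ P)
    {u : (Fin d → ℤ) → ℝ} (hu : ∀ c ∈ A, c ∉ P → 0 ≤ u c)
    (h0 : ∑ c ∈ A, u c • toReal c = 0) {c₀ : Fin d → ℤ} (hc₀ : c₀ ∈ A) (hc₀P : c₀ ∉ P) :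
    u c₀ = 0 := by
  classical
  by_contra hne
  have hpos : 0 < u c₀ := lt_of_le_of_ne (hu c₀ hc₀ hc₀P) (Ne.symm hne)
  -- The points of `A` have integer coordinates, so a ℚ-linear `φ` applied to the coefficients
  -- preserves the relation. Signs may change only at coefficients that were negative, and those
  -- belong to elements of `P`.
  obtain ⟨φ, hφ⟩ := exists_ratLinearMap_pos ((A.image u).filter (0 < ·))
    (fun s hs => (Finset.mem_filter.1 hs).2)
  have hφpos : ∀ c ∈ A, 0 < u c → 0 < φ (u c) := fun c hc h =>
    hφ _ (Finset.mem_filter.2 ⟨Finset.mem_image_of_mem _ hc, h⟩)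
  have hint : ∃ N : ℕ, 0 < N ∧ ∀ c ∈ A, ∃ z : ℤ, (z : ℚ) = N * φ (u c) := by
    refine ⟨∏ c ∈ A, (φ (u c)).den, Finset.prod_pos fun c _ => Rat.den_pos _, fun c hc => ?_⟩
    obtain ⟨k, hk⟩ := Finset.dvd_prod_of_mem (fun c => (φ (u c)).den) hc
    refine ⟨(φ (u c)).num * k, ?_⟩
    rw [hk]
    push_cast
    rw [← Rat.mul_den_eq_num (φ (u c))]
    ring
  obtain ⟨N, hN, hz⟩ := hint
  choose! z hz using hz
  have hsum : ∑ c ∈ A, z c • c = 0 := by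
    ext i
    have h1 : ∑ c ∈ A, (c i) • u c = 0 := by
      have := congrFun h0 i
      simpa [toReal, mul_comm] using this
    have h2 : ∑ c ∈ A, (c i) • φ (u c) = 0 := by
      have := congrArg φ h1
      rw [map_sum, map_zero] at this
      simpa only [map_zsmul] using this
    have h3 : (∑ c ∈ A, (z c : ℚ) * c i) = 0 := by
      rw [Finset.sum_congr rfl fun c hc => by rw [hz c hc]]
      have : ∑ c ∈ A, (N : ℚ) * φ (u c) * c i = N * ∑ c ∈ A, (c i) • φ (u c) := by
        rw [Finset.mul_sum]
        exact Finset.sum_congr rfl fun c _ => by rw [zsmul_eq_mul]; ring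
      rw [this, h2, mul_zero]
    simp only [Finset.sum_apply, Pi.smul_apply, Pi.zero_apply, smul_eq_mul]
    exact_mod_cast h3
  have hznn : ∀ c ∈ A, c ∉ P → 0 ≤ z c := by
    intro c hc hcP
    have : (0 : ℚ) ≤ z c := by
      rw [hz c hc]
      refine mul_nonneg (by positivity) ?_
      rcases (hu c hc hcP).eq_or_lt with h | h
      · rw [← h, map_zero]
      · exact (hφpos c hc h).le
    exact_mod_cast this
  have hzpos : 0 < z c₀ := by
    have : (0 : ℚ) < z c₀ := by
      rw [hz c₀ hc₀]
      exact mul_pos (by exact_mod_cast hN) (hφpos c₀ hc₀ hpos)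
    exact_mod_cast this
  -- Separate positive and negative parts. The negative side involves only elements of `P`, so the
  -- positive side lies in `P`, and so does its summand `c₀`.
  have heq : ∑ c ∈ A, (z c).toNat • c = ∑ c ∈ A, (-z c).toNat • c := by
    rw [← sub_eq_zero, ← Finset.sum_sub_distrib, ← hsum]
    refine Finset.sum_congr rfl fun c _ => ?_
    rw [← natCast_zsmul, ← natCast_zsmul, ← sub_smul, Int.toNat_sub_toNat_neg]
  have hmem : ∑ c ∈ A, (z c).toNat • c ∈ P := by
    rw [heq]
    refine sum_mem fun c hc => ?_
    by_cases hcP : c ∈ P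
    · exact P.nsmul_mem hcP _
    · have : (-z c).toNat = 0 := by have := hznn c hc hcP; omega
      rw [this, zero_smul]
      exact P.zero_mem
  have hA : ∀ c ∈ A, ∀ n : ℕ, n • c ∈ natSpan A := fun c hc n =>
    (natSpan A).nsmul_mem (AddSubmonoid.subset_closure hc) n
  rw [← Finset.add_sum_erase A _ hc₀] at hmem
  have h1 := hP _ (hA c₀ hc₀ _) _ (sum_mem fun c hc => hA c (Finset.mem_of_mem_erase hc) _) hmem
  obtain ⟨k, hk⟩ : ∃ k, (z c₀).toNat = k + 1 := ⟨(z c₀).toNat - 1, by omega⟩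
  rw [hk, succ_nsmul'] at h1
  exact hc₀P (hP _ (AddSubmonoid.subset_closure hc₀) _ (hA c₀ hc₀ k) h1)

open Classical in
/-- A face of the monoid `ℕA` gives a face of `A`. -/
theorem isFace_filter {A : Finset (Fin d → ℤ)} {P : AddSubmonoid (Fin d → ℤ)}
    (hP : ∀ x ∈ natSpan A, ∀ y ∈ natSpan A, x + y ∈ P → x ∈ P) :
    IsFace A (A.filter (· ∈ P)) where
  subset := Finset.filter_subset _ _
  isFaceOf := by
    refine ⟨Submodule.span_mono (Set.image_mono (Finset.coe_subset.2 (Finset.filter_subset _ _))),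
      ?_⟩
    intro x y a hx hy ha hxy
    rw [mem_realCone_iff] at hx hy hxy ⊢
    obtain ⟨u, hu, rfl⟩ := hx
    obtain ⟨v, hv, rfl⟩ := hy
    obtain ⟨t, ht, hxy⟩ := hxy
    -- The coefficients are nonnegative outside `P`, so they vanish there; since `a > 0` and both
    -- terms are nonnegative, `u` vanishes there as well.
    have h0 : ∑ c ∈ A, (a * u c + v c - if c ∈ P then t c else 0) • toReal c = 0 := by
      rw [Finset.smul_sum, Finset.sum_filter, ← Finset.sum_add_distrib] at hxy
      rw [← sub_eq_zero.2 hxy, ← Finset.sum_sub_distrib]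
      refine Finset.sum_congr rfl fun c _ => ?_
      split_ifs <;> simp [sub_smul, add_smul, mul_smul]
    have hzero : ∀ c ∈ A, c ∉ P → u c = 0 := by
      intro c hc hcP
      have h := eq_zero_of_sum_smul_toReal_eq_zero hP (fun c hc hcP => by
        rw [if_neg hcP, sub_zero]
        exact add_nonneg (mul_nonneg ha.le (hu c hc)) (hv c hc)) h0 hc hcP
      rw [if_neg hcP, sub_zero] at h
      have h1 := mul_nonneg ha.le (hu c hc)
      have h2 := hv c hc
      have h3 : a * u c = 0 := by linarith
      exact (mul_eq_zero.1 h3).resolve_left ha.ne'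
    refine ⟨u, fun c hc => hu c (Finset.mem_filter.1 hc).1, ?_⟩
    refine (Finset.sum_subset (Finset.filter_subset _ _) fun c hc hcP => ?_).symm
    rw [hzero c hc fun h => hcP (Finset.mem_filter.2 ⟨hc, h⟩), zero_smul]
  mem_iff := by
    intro c hc
    refine ⟨fun h => ?_, fun h => Submodule.subset_span ⟨c, h, rfl⟩⟩
    by_contra hcF
    have hcP : c ∉ P := fun h => hcF (Finset.mem_filter.2 ⟨hc, h⟩)
    obtain ⟨t, ht, hct⟩ := mem_realCone_iff.1 h
    have h0 : ∑ c' ∈ A, ((if c' = c then 1 else 0) - if c' ∈ P then t c' else 0) • toReal c'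
        = 0 := by
      simp only [sub_smul, Finset.sum_sub_distrib, ite_smul, one_smul, zero_smul]
      rw [← Finset.sum_filter (· ∈ P), ← hct]
      simp [hc]
    have h1 := eq_zero_of_sum_smul_toReal_eq_zero hP (fun c' _ hc'P => by
      rw [if_neg hc'P, sub_zero]; split_ifs <;> simp) h0 hc hcP
    simp [hcP] at h1

variable {A : Finset (Fin d → ℤ)}

theorem IsFace.natSpan_le {F : Finset (Fin d → ℤ)} (hF : IsFace A F) : natSpan F ≤ natSpan A :=
  AddSubmonoid.closure_mono (Finset.coe_subset.2 hF.subset)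

theorem IsFace.mem_of_mem_natSpan {F : Finset (Fin d → ℤ)} (hF : IsFace A F) {c : Fin d → ℤ}
    (hc : c ∈ A) (h : c ∈ natSpan F) : c ∈ F :=
  (hF.mem_iff c hc).1 (toReal_mem_realCone h)

/-- The face property passes from a sum to its summands, so every generator occurring in `x` lies in
the cone over `F`, hence in `F`. -/
theorem IsFace.mem_of_toReal_mem {F : Finset (Fin d → ℤ)} (hF : IsFace A F) {x : Fin d → ℤ}
    (hx : x ∈ natSpan A) : toReal x ∈ realCone F → x ∈ natSpan F := by
  induction hx using AddSubmonoid.closure_induction with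
  | mem x h => exact fun hx => AddSubmonoid.subset_closure ((hF.mem_iff x h).1 hx)
  | zero => exact fun _ => zero_mem _
  | add x y hx hy ihx ihy =>
    intro h
    rw [toReal_add] at h
    have h1 := hF.isFaceOf.mem_of_add_mem_left (toReal_mem_realCone hx) (toReal_mem_realCone hy) h
    rw [add_comm] at h
    have h2 := hF.isFaceOf.mem_of_add_mem_left (toReal_mem_realCone hy) (toReal_mem_realCone hx) h
    exact add_mem (ihx h1) (ihy h2)

/-- A face of `A` gives a face of the monoid `ℕA`. -/
theorem IsFace.mem_of_add_mem {F : Finset (Fin d → ℤ)} (hF : IsFace A F) {x y : Fin d → ℤ}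
    (hx : x ∈ natSpan A) (hy : y ∈ natSpan A) (h : x + y ∈ natSpan F) : x ∈ natSpan F := by
  refine hF.mem_of_toReal_mem hx ?_
  have := toReal_mem_realCone h
  rw [toReal_add] at this
  exact hF.isFaceOf.mem_of_add_mem_left (toReal_mem_realCone hx) (toReal_mem_realCone hy) this

theorem IsFace.subset_of_natSpan_le {F G : Finset (Fin d → ℤ)} (hF : IsFace A F)
    (hG : IsFace A G) (h : natSpan F ≤ natSpan G) : F ⊆ G := fun _ hc =>
  hG.mem_of_mem_natSpan (hF.subset hc) (h (AddSubmonoid.subset_closure hc))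

theorem natSpan_mono {F G : Finset (Fin d → ℤ)} (h : F ⊆ G) : natSpan F ≤ natSpan G :=
  AddSubmonoid.closure_mono (Finset.coe_subset.2 h)

theorem IsStronglyConvex.eq_zero_of_neg_mem (hA : IsStronglyConvex A) {x : Fin d → ℤ}
    (hx : x ∈ natSpan A) (hx' : -x ∈ natSpan A) : x = 0 := by
  have hneg : toReal (-x) = -toReal x := by ext; simp [toReal]
  have h := hA _ (toReal_mem_realCone hx) (hneg ▸ toReal_mem_realCone hx')
  ext i
  have := congrFun h i
  simpa [toReal] using this

/-- Strong convexity makes {0} a face of the monoid ℕA. The pairs with empty face are the single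
points, so every standard monomial gives a proper pair. -/
theorem IsStronglyConvex.isFace_empty (hA : IsStronglyConvex A) (hA0 : (0 : Fin d → ℤ) ∉ A) :
    IsFace A ∅ := by
  classical
  have h := isFace_filter (A := A) (P := ⊥) fun x hx y hy hxy => by
    rw [AddSubmonoid.mem_bot] at hxy ⊢
    exact hA.eq_zero_of_neg_mem hx (by rwa [neg_eq_of_add_eq_zero_right hxy])
  convert h
  refine (Finset.filter_eq_empty_iff.2 fun c hc hc0 => ?_).symm
  rw [AddSubmonoid.mem_bot] at hc0
  exact hA0 (hc0 ▸ hc)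

/-! ### Dickson's lemma and well-foundedness of divisibility -/

theorem exists_coeff {x : Fin d → ℤ} (hx : x ∈ natSpan A) :
    ∃ a : A → ℕ, x = ∑ i : A, a i • i.1 :=
  AddSubmonoid.mem_closure_finset'.1 hx

theorem sum_smul_mem_natSpan (a : A → ℕ) : ∑ i : A, a i • i.1 ∈ natSpan A :=
  AddSubmonoid.mem_closure_finset'.2 ⟨a, rfl⟩

theorem sum_smul_sub_mem_natSpan {a b : A → ℕ} (h : a ≤ b) :
    ∑ i : A, b i • i.1 - ∑ i : A, a i • i.1 ∈ natSpan A := by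
  have : ∑ i : A, b i • i.1 - ∑ i : A, a i • i.1 = ∑ i : A, (b - a) i • i.1 := by
    rw [← Finset.sum_sub_distrib]
    refine Finset.sum_congr rfl fun i _ => ?_
    rw [Pi.sub_apply, sub_nsmul _ (h i), sub_eq_add_neg]
  rw [this]
  exact sum_smul_mem_natSpan _

/-- Dickson's lemma for a pair of affine semigroups. -/
theorem exists_lt_sub_mem_natSpan {F : Finset (Fin d → ℤ)} {x y : ℕ → Fin d → ℤ}
    (hx : ∀ n, x n ∈ natSpan A) (hy : ∀ n, y n ∈ natSpan F) :
    ∃ m n, m < n ∧ x n - x m ∈ natSpan A ∧ y n - y m ∈ natSpan F := by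
  choose a ha using fun n => exists_coeff (hx n)
  choose b hb using fun n => exists_coeff (hy n)
  obtain ⟨m, n, hmn, h⟩ := wellQuasiOrdered_le (α := (A → ℕ) × (F → ℕ)) fun n => (a n, b n)
  refine ⟨m, n, hmn, ?_, ?_⟩
  · rw [ha n, ha m]; exact sum_smul_sub_mem_natSpan h.1
  · rw [hb n, hb m]; exact sum_smul_sub_mem_natSpan h.2

/-- Strict divisibility in `ℕA` is well founded. -/
theorem IsStronglyConvex.exists_minimal (hA : IsStronglyConvex A) {S : Set (Fin d → ℤ)}
    (hS : S ⊆ natSpan A) (hne : S.Nonempty) :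
    ∃ a ∈ S, ∀ b ∈ S, a - b ∈ natSpan A → b = a := by
  by_contra! h
  choose! g hgS hg hne' using h
  obtain ⟨a, ha⟩ := hne
  have hmem : ∀ n, g^[n] a ∈ S := fun n => by
    induction n with
    | zero => exact ha
    | succ n ih => rw [Function.iterate_succ_apply']; exact hgS _ ih
  have hdesc : ∀ m n, m ≤ n → g^[m] a - g^[n] a ∈ natSpan A := fun m n hmn => by
    induction n, hmn using Nat.le_induction with
    | base => rw [sub_self]; exact zero_mem _
    | succ n _ ih =>
      rw [Function.iterate_succ_apply']
      have := add_mem ih (hg _ (hmem n))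
      rwa [sub_add_sub_cancel] at this
  -- In an infinite descending chain Dickson's lemma finds an earlier term dividing a later one.
  -- Then the terms `m` and `m + 1` divide each other, hence coincide. The second sequence is a
  -- dummy.
  obtain ⟨m, n, hmn, h, -⟩ := exists_lt_sub_mem_natSpan (F := A) (fun n => hS (hmem n))
    (fun n => hS (hmem n))
  have h1 := hdesc (m + 1) n hmn
  have h2 := hg _ (hmem m)
  rw [← Function.iterate_succ_apply' g] at h2
  have h3 : g^[m + 1] a - g^[m] a ∈ natSpan A := by
    have := add_mem h1 h
    rwa [sub_add_sub_cancel] at this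
  have h4 := hA.eq_zero_of_neg_mem h3 (by rwa [neg_sub])
  refine hne' _ (hmem m) ?_
  rw [← Function.iterate_succ_apply' g]
  exact sub_eq_zero.1 h4

end AffineSemigroup

end

/-! ### Pairs and their divisor sets -/

noncomputable section

namespace AffineSemigroup

variable {d : ℕ}
variable {𝕜 : Type*} [Field 𝕜] {A : Finset (Fin d → ℤ)}

theorem monomial_mul (b c : natSpan A) :
    monomial 𝕜 b * monomial 𝕜 c = monomial 𝕜 (b + c) := by
  simp [monomial, AddMonoidAlgebra.single_mul_single]

theorem mem_stdMonomials_of_sub_mem {I : Ideal (SemigroupRing 𝕜 A)} {b x : Fin d → ℤ}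
    (hb : b ∈ natSpan A) (hx : x ∈ stdMonomials I) (h : x - b ∈ natSpan A) :
    b ∈ stdMonomials I := by
  obtain ⟨hxA, hx⟩ := hx
  refine ⟨hb, fun hbI => hx ?_⟩
  have := I.mul_mem_left (monomial 𝕜 ⟨x - b, h⟩) hbI
  rw [monomial_mul] at this
  convert this
  simp

namespace Pair

variable {p q : Pair A}

theorem add_mem_coset (p : Pair A) {f : Fin d → ℤ} (hf : f ∈ natSpan p.face) :
    p.base + f ∈ p.coset :=
  ⟨f, hf, rfl⟩

theorem base_mem_coset (p : Pair A) : p.base ∈ p.coset :=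
  ⟨0, zero_mem _, (add_zero _).symm⟩

theorem coset_subset (p : Pair A) {x : Fin d → ℤ} (hx : x ∈ p.coset) : x ∈ natSpan A := by
  obtain ⟨f, hf, rfl⟩ := hx
  exact add_mem p.base_mem (p.isFace.natSpan_le hf)

/-- If a and a + f both lie in b + ℕG, then f + g ∈ ℕG for some g ∈ ℕG, and the face property gives
f ∈ ℕG. -/
theorem Prec.face_subset (h : p.Prec q) : p.face ⊆ q.face := by
  refine p.isFace.subset_of_natSpan_le q.isFace fun f hf => ?_
  obtain ⟨g, hg, hpg⟩ := h p.base_mem_coset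
  obtain ⟨g', hg', hpg'⟩ := h (p.add_mem_coset hf)
  have : f + g = g' := by
    rw [hpg] at hpg'
    have h' : q.base + (f + g) = q.base + g' := by rw [← hpg']; abel
    exact add_left_cancel h'
  exact q.isFace.mem_of_add_mem (p.isFace.natSpan_le hf) (q.isFace.natSpan_le hg) (this ▸ hg')

/-- The elements of `ℕA` which divide some element of `a + ℕF`. -/
def divisors (p : Pair A) : Set (Fin d → ℤ) :=
  {b | b ∈ natSpan A ∧ ∃ x ∈ p.coset, x - b ∈ natSpan A}

theorem mem_divisors_of_mem_coset {x : Fin d → ℤ} (hx : x ∈ p.coset) : x ∈ p.divisors :=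
  ⟨p.coset_subset hx, x, hx, by rw [sub_self]; exact zero_mem _⟩

theorem mem_divisors_of_sub_mem {b c : Fin d → ℤ} (hb : b ∈ natSpan A) (hc : c ∈ p.divisors)
    (h : c - b ∈ natSpan A) : b ∈ p.divisors := by
  obtain ⟨-, x, hx, hxc⟩ := hc
  exact ⟨hb, x, hx, by have := add_mem hxc h; rwa [sub_add_sub_cancel] at this⟩

theorem add_mem_divisors {b f : Fin d → ℤ} (hb : b ∈ p.divisors) (hf : f ∈ natSpan p.face) :
    b + f ∈ p.divisors := by
  obtain ⟨hbA, _, ⟨g, hg, rfl⟩, h⟩ := hb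
  refine ⟨add_mem hbA (p.isFace.natSpan_le hf), _, p.add_mem_coset (add_mem hg hf), ?_⟩
  rwa [← add_assoc, add_sub_add_right_eq_sub]

/-- The divisors of `q` are closed under translation by ℕ`q.face` and under passing to divisors, so
containing the base of `p` suffices. -/
theorem divisors_subset_iff (hpq : p.face ⊆ q.face) :
    p.divisors ⊆ q.divisors ↔ p.base ∈ q.divisors := by
  refine ⟨fun h => h (mem_divisors_of_mem_coset p.base_mem_coset), fun h b hb => ?_⟩
  obtain ⟨hbA, _, ⟨f, hf, rfl⟩, h'⟩ := hb
  exact mem_divisors_of_sub_mem hbA (add_mem_divisors h (natSpan_mono hpq hf)) h'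

theorem divides_iff (hpq : p.face ⊆ q.face) : p.Divides q ↔ p.base ∈ q.divisors := by
  constructor
  · rintro ⟨c, hc, h⟩
    have := h 0 (zero_mem _)
    exact ⟨p.base_mem, _, this, by simpa using hc⟩
  · rintro ⟨-, _, ⟨g, hg, rfl⟩, h⟩
    refine ⟨_, h, fun f hf => ⟨g + f, add_mem hg (natSpan_mono hpq hf), ?_⟩⟩
    abel

theorem Divides.base_mem_divisors (h : p.Divides q) : p.base ∈ q.divisors := by
  obtain ⟨c, hc, h⟩ := h
  exact ⟨p.base_mem, _, h 0 (zero_mem _), by simpa using hc⟩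

theorem Divides.face_subset (h : p.Divides q) : p.face ⊆ q.face := by
  obtain ⟨c, hc, h⟩ := h
  let r : Pair A := ⟨p.base + c, add_mem p.base_mem hc, p.face, p.isFace⟩
  refine Prec.face_subset (p := r) ?_
  rintro _ ⟨f, hf, rfl⟩
  exact h f hf

theorem sub_mem_intSpan {F : Finset (Fin d → ℤ)} {x y : Fin d → ℤ} (hx : x ∈ natSpan F)
    (hy : y ∈ natSpan F) : x - y ∈ intSpan F := by
  have h : natSpan F ≤ (intSpan F).toAddSubmonoid :=
    AddSubmonoid.closure_le.2 AddSubgroup.subset_closure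
  exact sub_mem (h hx) (h hy)

theorem exists_sub_eq_of_mem_intSpan {F : Finset (Fin d → ℤ)} {x : Fin d → ℤ}
    (hx : x ∈ intSpan F) : ∃ f ∈ natSpan F, ∃ g ∈ natSpan F, x = f - g := by
  induction hx using AddSubgroup.closure_induction with
  | mem x h => exact ⟨x, AddSubmonoid.subset_closure h, 0, zero_mem _, (sub_zero _).symm⟩
  | zero => exact ⟨0, zero_mem _, 0, zero_mem _, (sub_zero _).symm⟩
  | add x y _ _ hx hy =>
    obtain ⟨f, hf, g, hg, rfl⟩ := hx
    obtain ⟨f', hf', g', hg', rfl⟩ := hy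
    exact ⟨_, add_mem hf hf', _, add_mem hg hg', by abel⟩
  | neg x _ hx =>
    obtain ⟨f, hf, g, hg, rfl⟩ := hx
    exact ⟨g, hg, f, hf, by abel⟩

/-- Pairs of the same face with the same divisors overlap. -/
theorem overlap_of_divisors_eq (hpq : p.face = q.face) (h : p.divisors = q.divisors) :
    p.Overlap q := by
  refine ⟨hpq, ?_⟩
  obtain ⟨-, _, ⟨g, hg, rfl⟩, h1⟩ := (divisors_subset_iff hpq.subset).1 h.subset
  obtain ⟨-, _, ⟨f, hf, rfl⟩, h2⟩ := (divisors_subset_iff hpq.superset).1 h.superset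
  rw [← hpq] at hg
  -- The two cofactors lie in ℕA and add up to g + f ∈ ℕF, so each of them lies in ℕF.
  have hsum : (q.base + g - p.base) + (p.base + f - q.base) ∈ natSpan p.face := by
    have : (q.base + g - p.base) + (p.base + f - q.base) = g + f := by abel
    rw [this]
    exact add_mem hg hf
  have hmem := p.isFace.mem_of_add_mem h1 h2 hsum
  have : p.base - q.base = g - (q.base + g - p.base) := by abel
  rw [this]
  exact sub_mem_intSpan hg hmem

theorem Overlap.divisors_subset (h : p.Overlap q) : p.divisors ⊆ q.divisors := by
  rw [divisors_subset_iff h.1.subset]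
  obtain ⟨f, hf, g, hg, hfg⟩ := exists_sub_eq_of_mem_intSpan h.2
  rw [h.1] at hf hg
  refine ⟨p.base_mem, _, q.add_mem_coset hf, ?_⟩
  have : q.base + f - p.base = g := by
    rw [eq_add_of_sub_eq hfg]
    abel
  rw [this]
  exact q.isFace.natSpan_le hg

/-- Multiples of an element outside `ℕF` eventually leave the divisors of `a + ℕF`. -/
theorem exists_nsmul_notMem_divisors (p : Pair A) {c : Fin d → ℤ} (hc : c ∈ natSpan A)
    (hcF : c ∉ natSpan p.face) : ∃ n : ℕ, n • c ∉ p.divisors := by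
  by_contra! h
  choose _ x hx hxc using h
  choose f hf hxf using hx
  -- Here `x n = p.base + f n` is a multiple of `n • c`. Dickson's lemma, applied to the cofactors
  -- and to `f`, writes an element of ℕF as `(n - m) • c` plus an element of ℕA, which forces `c`
  -- into ℕF.
  obtain ⟨m, n, hmn, h1, h2⟩ := exists_lt_sub_mem_natSpan hxc hf
  obtain ⟨k, rfl⟩ := Nat.exists_eq_add_of_lt hmn
  have h3 : c + (k • c + (x (m + k + 1) - (m + k + 1) • c - (x m - m • c))) = f (m + k + 1) - f m
      := by
    rw [hxf, hxf, add_smul, add_smul, one_smul]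
    abel
  refine hcF (p.isFace.mem_of_add_mem hc (add_mem (nsmul_mem hc k) h1) ?_)
  rwa [h3]

end Pair

/-! ### Standard pairs: existence and finiteness -/

open Pair

variable {I : Ideal (SemigroupRing 𝕜 A)}

theorem IsProperPair.divisors_subset {p : Pair A} (hp : IsProperPair I p) :
    p.divisors ⊆ stdMonomials I := by
  rintro b ⟨hb, x, hx, h⟩
  exact mem_stdMonomials_of_sub_mem hb (hp hx) h

/-- Among the proper pairs containing `p`, take one of maximal face and then, for that face, a base
minimal for divisibility. A larger proper pair must have the same face and a base dividing this one,
hence the same base. -/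
theorem IsProperPair.exists_isStandardPair (hA : IsStronglyConvex A) {p : Pair A}
    (hp : IsProperPair I p) : ∃ q : Pair A, IsStandardPair I q ∧ p.Prec q := by
  let S : Set (Pair A) := {q | IsProperPair I q ∧ p.Prec q}
  have hSfin : ((fun q : Pair A => q.face) '' S).Finite :=
    A.powerset.finite_toSet.subset (by
      rintro _ ⟨q, -, rfl⟩
      exact Finset.mem_coe.2 (Finset.mem_powerset.2 q.isFace.subset))
  obtain ⟨r, ⟨hr, hpr⟩, hmax⟩ := Set.Finite.exists_maximalFor' (fun q : Pair A => q.face) S hSfin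
    ⟨p, hp, fun _ h => h⟩
  obtain ⟨a, ⟨q, ⟨hq, hpq⟩, hqr, rfl⟩, hmin⟩ := hA.exists_minimal
    (S := {a | ∃ q ∈ S, q.face = r.face ∧ q.base = a})
    (by rintro _ ⟨q, -, -, rfl⟩; exact q.base_mem) ⟨_, r, ⟨hr, hpr⟩, rfl, rfl⟩
  refine ⟨q, ⟨hq, fun s hs hqs => ?_⟩, hpq⟩
  have hsS : s ∈ S := ⟨hs, fun x hx => hqs (hpq hx)⟩
  have hrs : r.face ⊆ s.face := hqr ▸ hqs.face_subset
  have hsr : s.face = r.face := Finset.Subset.antisymm (hmax hsS hrs) hrs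
  obtain ⟨f, hf, hqf⟩ := hqs q.base_mem_coset
  have hbase : s.base = q.base := hmin _ ⟨s, hsS, hsr, rfl⟩ (by
    rw [hqf, add_sub_cancel_left]
    exact s.isFace.natSpan_le hf)
  rintro _ ⟨g, hg, rfl⟩
  rw [hbase]
  exact q.add_mem_coset (by rwa [hqr, ← hsr])

theorem IsStandardPair.face_eq {p : Pair A} (hp : IsStandardPair I p) {G : Finset (Fin d → ℤ)}
    (hG : IsFace A G) (hFG : p.face ⊆ G)
    (h : ∀ g ∈ natSpan G, p.base + g ∈ stdMonomials I) : G = p.face := by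
  let q : Pair A := ⟨p.base, p.base_mem, G, hG⟩
  refine Finset.Subset.antisymm (Prec.face_subset (p := q) (hp.2 q ?_ ?_)) hFG
  · rintro _ ⟨g, hg, rfl⟩
    exact h g hg
  · rintro _ ⟨f, hf, rfl⟩
    exact ⟨f, natSpan_mono hFG hf, rfl⟩

/-- Translates of the base of `p` by ℕ`q.face` remain divisors of `q`, hence standard, so maximality
of `p` forbids a larger face. Thus divisibility between standard pairs never changes the face. -/
theorem IsStandardPair.face_eq_of_mem_divisors {p q : Pair A} (hp : IsStandardPair I p)
    (hq : IsProperPair I q) (hpq : p.face ⊆ q.face) (h : p.base ∈ q.divisors) :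
    q.face = p.face :=
  hp.face_eq q.isFace hpq fun _ hg => hq.divisors_subset (add_mem_divisors h hg)

/-- Otherwise the divisors in ℕA of elements of ℕc + ℕF form a face of the monoid whose translate by
the base is standard. It contains `c` and the face of `p`, contradicting maximality. -/
theorem IsStandardPair.exists_add_nsmul_notMem {p : Pair A} (hp : IsStandardPair I p)
    {c : Fin d → ℤ} (hc : c ∈ A) (hcF : c ∉ p.face) :
    ∃ n : ℕ, ∃ f ∈ natSpan p.face, p.base + n • c + f ∉ stdMonomials I := by
  classical
  by_contra! h
  have hcA : c ∈ natSpan A := AddSubmonoid.subset_closure hc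
  let P : AddSubmonoid (Fin d → ℤ) :=
    { carrier := {m | m ∈ natSpan A ∧
        ∃ n : ℕ, ∃ f ∈ natSpan p.face, n • c + f - m ∈ natSpan A}
      zero_mem' := ⟨zero_mem _, 0, 0, zero_mem _, by simp⟩
      add_mem' := by
        rintro x y ⟨hx, n, f, hf, hxf⟩ ⟨hy, n', f', hf', hyf⟩
        refine ⟨add_mem hx hy, n + n', f + f', add_mem hf hf', ?_⟩
        have := add_mem hxf hyf
        convert this using 1
        rw [add_smul]
        abel }
  have hface := isFace_filter (A := A) (P := P) fun x hx y hy hxy => by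
    obtain ⟨-, n, f, hf, hxyf⟩ := hxy
    refine ⟨hx, n, f, hf, ?_⟩
    have := add_mem hxyf hy
    convert this using 1
    abel
  have hle : natSpan (A.filter (· ∈ P)) ≤ P := by
    rw [AddSubmonoid.closure_le]
    intro x hx
    exact (Finset.mem_filter.1 (Finset.mem_coe.1 hx)).2
  have hFG : p.face ⊆ A.filter (· ∈ P) := fun f hf => Finset.mem_filter.2
    ⟨p.isFace.subset hf, AddSubmonoid.subset_closure (p.isFace.subset hf), 0, f,
      AddSubmonoid.subset_closure hf, by simp⟩
  have hcG : c ∈ A.filter (· ∈ P) := Finset.mem_filter.2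
    ⟨hc, hcA, 1, 0, zero_mem _, by simp⟩
  rw [hp.face_eq hface hFG fun g hg => ?_] at hcG
  · exact hcF hcG
  · obtain ⟨hgA, n, f, hf, hgf⟩ := hle hg
    refine mem_stdMonomials_of_sub_mem (add_mem p.base_mem hgA) (h n f hf) ?_
    convert hgf using 1
    abel

/-- An infinite set of vectors of natural numbers contains a vector `s` such that the elements
of the set above `s` are not bounded. -/
theorem exists_mem_forall_exists_not_le {ι : Type*} [Finite ι] {S : Set (ι → ℕ)}
    (hS : S.Infinite) : ∃ s ∈ S, ∀ N : ι → ℕ, ∃ t ∈ S, s ≤ t ∧ ¬ t ≤ N := by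
  classical
  have := Fintype.ofFinite ι
  obtain ⟨g, hg⟩ := (wellQuasiOrdered_le (α := ι → ℕ)).exists_monotone_subseq
    fun n => (hS.natEmbedding S n : ι → ℕ)
  refine ⟨_, (hS.natEmbedding S (g 0)).2, fun N => ?_⟩
  by_contra! h
  have hinj : Function.Injective fun n => (hS.natEmbedding S (g n) : ι → ℕ) :=
    Subtype.val_injective.comp ((hS.natEmbedding S).injective.comp g.injective)
  refine Set.infinite_range_of_injective hinj ((Set.finite_Icc 0 N).subset ?_)
  rintro _ ⟨n, rfl⟩
  exact ⟨zero_le, h _ (hS.natEmbedding S (g n)).2 (hg 0 n (Nat.zero_le n))⟩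

theorem exists_eq_sum_sdiff_add [DecidableEq (Fin d → ℤ)] {F : Finset (Fin d → ℤ)}
    {x : Fin d → ℤ} (hx : x ∈ natSpan A) :
    ∃ s : ↥(A \ F) → ℕ, ∃ f ∈ natSpan F, x = ∑ i, s i • i.1 + f := by
  induction hx using AddSubmonoid.closure_induction with
  | mem x h =>
    by_cases hxF : x ∈ F
    · exact ⟨0, x, AddSubmonoid.subset_closure hxF, by simp⟩
    · refine ⟨Pi.single ⟨x, Finset.mem_sdiff.2 ⟨h, hxF⟩⟩ 1, 0, zero_mem _, ?_⟩
      rw [add_zero, Finset.sum_eq_single ⟨x, Finset.mem_sdiff.2 ⟨h, hxF⟩⟩] <;>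
        simp +contextual
  | zero => exact ⟨0, 0, zero_mem _, by simp⟩
  | add x y _ _ hx hy =>
    obtain ⟨s, f, hf, rfl⟩ := hx
    obtain ⟨t, g, hg, rfl⟩ := hy
    refine ⟨s + t, f + g, add_mem hf hg, ?_⟩
    simp only [Pi.add_apply, add_smul, Finset.sum_add_distrib]
    abel

/-- The standard pairs belonging to `F` form finitely many overlap classes. -/
theorem finite_divisors_image (I : Ideal (SemigroupRing 𝕜 A)) (F : Finset (Fin d → ℤ)) :
    (divisors '' {p : Pair A | IsStandardPair I p ∧ p.face = F}).Finite := by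
  classical
  let S : Set (↥(A \ F) → ℕ) := {s | ∃ p : Pair A, IsStandardPair I p ∧ p.face = F ∧
    ∃ f ∈ natSpan F, p.base = ∑ i, s i • i.1 + f}
  have hSA : ∀ s : ↥(A \ F) → ℕ, ∑ i, s i • i.1 ∈ natSpan A := fun s =>
    natSpan_mono Finset.sdiff_subset (sum_smul_mem_natSpan s)
  have hS : S.Finite := by
    -- Suppose the exponent vectors outside `F` are infinitely many, and take `s` with unbounded
    -- vectors above it. Moving by `N c` in direction `c` from the base over `s` reaches a
    -- nonstandard monomial, up to adding `g c`. Some `t ≥ s` exceeds `s + N` at a coordinate `c`,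
    -- so that monomial divides an element of a standard pair.
    by_contra hinf
    obtain ⟨s, ⟨p, hp, rfl, f, hf, hpf⟩, h⟩ := exists_mem_forall_exists_not_le hinf
    choose N g hg hN using fun c : ↥(A \ p.face) =>
      hp.exists_add_nsmul_notMem (Finset.mem_sdiff.1 c.2).1 (Finset.mem_sdiff.1 c.2).2
    obtain ⟨t, ⟨q, hq, hqp, f', hf', hqf⟩, hst, ht⟩ := h (s + N)
    obtain ⟨c, hc⟩ := not_forall.1 ht
    have hle : s + Pi.single c (N c) ≤ t := by
      intro c'
      by_cases hcc : c' = c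
      · subst hcc
        simp only [Pi.add_apply, Pi.single_eq_same] at hc ⊢
        omega
      · simpa [hcc] using hst c'
    have hsum : ∑ i, (s + Pi.single c (N c) : ↥(A \ p.face) → ℕ) i • i.1 = ∑ i, s i • i.1 + N c • c.1 := by
      simp only [Pi.add_apply, add_smul, Finset.sum_add_distrib]
      congr 1
      rw [Finset.sum_eq_single c] <;> simp +contextual
    have hsub := natSpan_mono Finset.sdiff_subset (sum_smul_sub_mem_natSpan hle)
    rw [hsum] at hsub
    refine hN c (mem_stdMonomials_of_sub_mem (x := q.base + (f + g c)) ?_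
      (hq.1 (q.add_mem_coset (by rw [hqp]; exact add_mem hf (hg c)))) ?_)
    · exact add_mem (add_mem p.base_mem
        (nsmul_mem (AddSubmonoid.subset_closure (Finset.mem_sdiff.1 c.2).1) _))
        (p.isFace.natSpan_le (hg c))
    · have := add_mem hsub (p.isFace.natSpan_le hf')
      convert this using 1
      rw [hqf, hpf]
      abel
  -- The ℕF part of the base does not affect the divisors, so they depend on the exponent vector
  -- alone.
  refine (hS.image fun s => {b | b ∈ natSpan A ∧
    ∃ f ∈ natSpan F, ∑ i, s i • i.1 + f - b ∈ natSpan A}).subset ?_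
  rintro _ ⟨p, ⟨hp, rfl⟩, rfl⟩
  obtain ⟨s, f, hf, hpf⟩ := exists_eq_sum_sdiff_add (F := p.face) p.base_mem
  refine ⟨s, ⟨p, hp, rfl, f, hf, hpf⟩, ?_⟩
  ext b
  refine and_congr_right fun hb => ⟨?_, ?_⟩
  · rintro ⟨g, hg, h⟩
    refine ⟨_, p.add_mem_coset hg, ?_⟩
    have := add_mem h (p.isFace.natSpan_le hf)
    convert this using 1
    rw [hpf]
    abel
  · rintro ⟨_, ⟨g, hg, rfl⟩, h⟩
    refine ⟨f + g, add_mem hf hg, ?_⟩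
    rwa [hpf, add_assoc] at h

/-- Every standard pair divides a standard pair with maximal overlap class. -/
theorem IsStandardPair.exists_isMaximalStandardPair {p : Pair A} (hp : IsStandardPair I p) :
    ∃ q : Pair A, IsMaximalStandardPair I q ∧ q.face = p.face ∧ p.divisors ⊆ q.divisors := by
  obtain ⟨q, ⟨hq, hqp, hpq⟩, hmax⟩ := Set.Finite.exists_maximalFor' (divisors (A := A))
    {q | IsStandardPair I q ∧ q.face = p.face ∧ p.divisors ⊆ q.divisors}
    ((finite_divisors_image I p.face).subset
      (Set.image_mono fun q hq => ⟨hq.1, hq.2.1⟩)) ⟨p, hp, rfl, subset_rfl⟩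
  refine ⟨q, ⟨hq, fun r hr hqr => ?_⟩, hqp, hpq⟩
  -- Any standard pair divided by `q` has the same face, so maximality of the divisor set within one
  -- face is enough.
  have hrq : r.face = q.face :=
    hq.face_eq_of_mem_divisors hr.1 hqr.face_subset hqr.base_mem_divisors
  have hsub := (divisors_subset_iff hrq.superset).2 hqr.base_mem_divisors
  exact overlap_of_divisors_eq hrq
    (Set.Subset.antisymm (hmax ⟨hr, hrq.trans hqp, hpq.trans hsub⟩ hsub) hsub)

end AffineSemigroup

end

/-! ### Monomial ideals of divisor-closed sets: prime and primary criteria -/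

noncomputable section

namespace AffineSemigroup

variable {d : ℕ} {𝕜 : Type*} [Field 𝕜] {A : Finset (Fin d → ℤ)}

instance : NoZeroDivisors (SemigroupRing 𝕜 A) := by
  have : UniqueSums (natSpan A) := UniqueSums.of_injective_addHom
    (natSpan A).subtype.toAddHom Subtype.val_injective inferInstance
  infer_instance

theorem monomial_zero : monomial 𝕜 (0 : natSpan A) = 1 := rfl

theorem monomial_pow (b : natSpan A) (n : ℕ) : monomial 𝕜 b ^ n = monomial 𝕜 (n • b) := by
  induction n with
  | zero => rw [pow_zero, zero_smul, monomial_zero]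
  | succ n ih => rw [pow_succ, ih, monomial_mul, succ_nsmul]

variable (𝕜 A) in
/-- The ideal generated by the monomials with exponents outside `S`. -/
def stdIdeal (S : Set (Fin d → ℤ)) : Ideal (SemigroupRing 𝕜 A) :=
  Ideal.span (monomial 𝕜 '' {b | (b : Fin d → ℤ) ∉ S})

variable (A) in
/-- `S` contains the divisors in `ℕA` of its elements. -/
def IsDivisorClosed (S : Set (Fin d → ℤ)) : Prop :=
  ∀ b ∈ natSpan A, ∀ c ∈ natSpan A, b + c ∈ S → b ∈ S

variable {S : Set (Fin d → ℤ)}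

/-- Divisor-closedness of `S` makes the generating exponents closed under multiples, so membership
is read off the support. -/
theorem mem_stdIdeal (hS : IsDivisorClosed A S) {x : SemigroupRing 𝕜 A} :
    x ∈ stdIdeal 𝕜 A S ↔ ∀ m ∈ x.coeff.support, (m : Fin d → ℤ) ∉ S := by
  refine AddMonoidAlgebra.mem_ideal_span_of'_image.trans (forall₂_congr fun m _ => ⟨?_, fun h =>
    ⟨m, h, 0, (zero_add m).symm⟩⟩)
  rintro ⟨m', hm', c, rfl⟩ h
  refine hm' (hS _ m'.2 _ c.2 ?_)
  rwa [add_comm]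

theorem monomial_mem_stdIdeal (hS : IsDivisorClosed A S) {b : natSpan A} :
    monomial 𝕜 b ∈ stdIdeal 𝕜 A S ↔ (b : Fin d → ℤ) ∉ S := by
  rw [mem_stdIdeal hS, monomial, AddMonoidAlgebra.coeff_single,
    Finsupp.support_single _ one_ne_zero]
  simp

theorem stdMonomials_stdIdeal (hS : IsDivisorClosed A S) (hSA : S ⊆ natSpan A) :
    stdMonomials (stdIdeal 𝕜 A S) = S := by
  ext b
  refine ⟨?_, fun h => ⟨hSA h, ?_⟩⟩
  · rintro ⟨hb, h⟩
    rw [monomial_mem_stdIdeal hS] at h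
    exact not_not.1 h
  · rw [monomial_mem_stdIdeal hS]
    exact not_not.2 h

theorem isDivisorClosed_stdMonomials (I : Ideal (SemigroupRing 𝕜 A)) :
    IsDivisorClosed A (stdMonomials I) := fun b hb c hc h =>
  mem_stdMonomials_of_sub_mem hb h (by rwa [add_sub_cancel_left])

theorem monomial_mem_iff {I : Ideal (SemigroupRing 𝕜 A)} {b : natSpan A} :
    monomial 𝕜 b ∈ I ↔ (b : Fin d → ℤ) ∉ stdMonomials I :=
  ⟨fun h ⟨_, h'⟩ => h' h, fun h => by
    by_contra h'
    exact h ⟨b.2, h'⟩⟩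

theorem IsMonomialIdeal.eq_stdIdeal {I : Ideal (SemigroupRing 𝕜 A)} (hI : IsMonomialIdeal I) :
    I = stdIdeal 𝕜 A (stdMonomials I) := by
  apply le_antisymm
  · obtain ⟨s, hs⟩ := hI
    nth_rw 1 [hs]
    refine Ideal.span_mono (Set.image_mono fun b hb => ?_)
    rw [Set.mem_ofPred_eq, ← monomial_mem_iff, hs]
    exact Ideal.subset_span ⟨b, hb, rfl⟩
  · rw [stdIdeal, Ideal.span_le]
    rintro _ ⟨b, hb, rfl⟩
    exact monomial_mem_iff.2 hb

theorem exists_eq_add_mem_stdIdeal (hS : IsDivisorClosed A S) (x : SemigroupRing 𝕜 A) :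
    ∃ u v, x = u + v ∧ (∀ m ∈ u.coeff.support, (m : Fin d → ℤ) ∈ S) ∧ v ∈ stdIdeal 𝕜 A S := by
  classical
  refine ⟨.ofCoeff (x.coeff.filter fun m => (m : Fin d → ℤ) ∈ S),
    .ofCoeff (x.coeff.filter fun m => ¬ (m : Fin d → ℤ) ∈ S), ?_, fun m hm => ?_, ?_⟩
  · refine AddMonoidAlgebra.coeff_injective ?_
    rw [AddMonoidAlgebra.coeff_add, AddMonoidAlgebra.coeff_ofCoeff,
      AddMonoidAlgebra.coeff_ofCoeff, Finsupp.filter_add_filter_not]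
  · rw [AddMonoidAlgebra.coeff_ofCoeff, Finsupp.support_filter, Finset.mem_filter] at hm
    exact hm.2
  · rw [mem_stdIdeal hS]
    intro m hm
    rw [AddMonoidAlgebra.coeff_ofCoeff, Finsupp.support_filter, Finset.mem_filter] at hm
    exact hm.2

/-- If `S` is stable under translation by `ℕF`, the nonzero elements of `𝕜[ℕF]` are not zero
divisors modulo the monomial ideal with standard monomials `S`. -/
theorem mem_stdIdeal_of_mul_mem {F : Finset (Fin d → ℤ)} (hS : IsDivisorClosed A S)
    (hSF : ∀ b ∈ S, ∀ f ∈ natSpan F, b + f ∈ S) {x y : SemigroupRing 𝕜 A} (hy0 : y ≠ 0)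
    (hy : ∀ m ∈ y.coeff.support, (m : Fin d → ℤ) ∈ natSpan F)
    (hyx : y * x ∈ stdIdeal 𝕜 A S) : x ∈ stdIdeal 𝕜 A S := by
  classical
  obtain ⟨u, v, rfl, hu, hv⟩ := exists_eq_add_mem_stdIdeal hS x
  have hyu : y * u ∈ stdIdeal 𝕜 A S := by
    rw [mul_add] at hyx
    exact (Ideal.add_mem_iff_left _ (Ideal.mul_mem_left _ y hv)).1 hyx
  -- The support of `y * u` lies in `S` by stability under ℕF and avoids `S` by membership in the
  -- ideal, so it is empty.
  have hzero : y * u = 0 := by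
    refine AddMonoidAlgebra.coeff_injective (Finsupp.support_eq_empty.1 ?_)
    refine Finset.eq_empty_of_forall_notMem fun m hm => (mem_stdIdeal hS).1 hyu m hm ?_
    obtain ⟨a, ha, b, hb, rfl⟩ := Finset.mem_add.1
      (AddMonoidAlgebra.support_coeff_mul_subset y u hm)
    rw [AddSubmonoid.coe_add, add_comm]
    exact hSF _ (hu b hb) _ (hy a ha)
  rw [(mul_eq_zero.1 hzero).resolve_left hy0, zero_add]
  exact hv

theorem IsFace.isDivisorClosed {F : Finset (Fin d → ℤ)} (hF : IsFace A F) :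
    IsDivisorClosed A (natSpan F : Set (Fin d → ℤ)) := fun _ hb _ hc h =>
  hF.mem_of_add_mem hb hc h

theorem facePrime_eq (F : Finset (Fin d → ℤ)) :
    facePrime 𝕜 A F = stdIdeal 𝕜 A (natSpan F : Set (Fin d → ℤ)) := rfl

theorem ne_zero_of_add_notMem {J : Ideal (SemigroupRing 𝕜 A)} {u v : SemigroupRing 𝕜 A}
    (hv : v ∈ J) (h : u + v ∉ J) : u ≠ 0 := by
  rintro rfl
  exact h (by rwa [zero_add])

theorem stdIdeal_ne_top (hS : IsDivisorClosed A S) (h0 : 0 ∈ S) : stdIdeal 𝕜 A S ≠ ⊤ := by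
  rw [Ne, Ideal.eq_top_iff_one, ← monomial_zero, monomial_mem_stdIdeal hS]
  exact not_not.2 h0

/-- Modulo the ideal, an element outside it is represented by a nonzero element of 𝕜[ℕF], which is a
nonzerodivisor there. -/
theorem IsFace.isPrime_facePrime {F : Finset (Fin d → ℤ)} (hF : IsFace A F) :
    (facePrime 𝕜 A F).IsPrime := by
  rw [facePrime_eq]
  refine ⟨stdIdeal_ne_top hF.isDivisorClosed (zero_mem (natSpan F)), fun {x y} hxy => ?_⟩
  by_contra! h
  obtain ⟨hx, hy⟩ := h
  obtain ⟨u, v, rfl, hu, hv⟩ := exists_eq_add_mem_stdIdeal hF.isDivisorClosed x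
  refine hy (mem_stdIdeal_of_mul_mem hF.isDivisorClosed (fun b hb f hf => add_mem hb hf)
    (ne_zero_of_add_notMem hv hx) hu ?_)
  rw [add_mul] at hxy
  exact (Ideal.add_mem_iff_left _ (Ideal.mul_mem_right _ _ hv)).1 hxy

/-- Stability and `h0` give ℕF ⊆ S, so the ideal lies in 𝔭_F; `hnil` makes the generators of 𝔭_F
nilpotent modulo the ideal. An element outside 𝔭_F is a nonzero element of 𝕜[ℕF] plus a nilpotent,
so it is a nonzerodivisor. -/
theorem IsFace.isPrimaryTo_stdIdeal {F : Finset (Fin d → ℤ)} (hF : IsFace A F)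
    (hS : IsDivisorClosed A S) (h0 : 0 ∈ S) (hSF : ∀ b ∈ S, ∀ f ∈ natSpan F, b + f ∈ S)
    (hnil : ∀ c ∈ natSpan A, c ∉ natSpan F → ∃ n : ℕ, n • c ∉ S) :
    IsPrimaryTo (stdIdeal 𝕜 A S) (facePrime 𝕜 A F) := by
  have hrad : (stdIdeal 𝕜 A S).radical = facePrime 𝕜 A F := by
    apply le_antisymm
    · rw [hF.isPrime_facePrime.radical_le_iff]
      refine Ideal.span_mono (Set.image_mono fun b hb hbF => hb ?_)
      have := hSF 0 h0 _ hbF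
      rwa [zero_add] at this
    · rw [facePrime, Ideal.span_le]
      rintro _ ⟨c, hc, rfl⟩
      obtain ⟨n, hn⟩ := hnil c c.2 hc
      refine ⟨n, ?_⟩
      rw [monomial_pow, monomial_mem_stdIdeal hS]
      exact hn
  refine ⟨Ideal.isPrimary_iff.2 ⟨stdIdeal_ne_top hS h0, fun {x y} hxy => ?_⟩, hrad⟩
  by_contra! h
  obtain ⟨hx, hy⟩ := h
  rw [hrad, facePrime_eq] at hy
  obtain ⟨u, v, rfl, hu, hv⟩ := exists_eq_add_mem_stdIdeal hF.isDivisorClosed y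
  have hu0 := ne_zero_of_add_notMem hv hy
  have hv' : v ∈ (stdIdeal 𝕜 A S).radical := by rwa [hrad]
  have hex : ∃ n, x * v ^ n ∈ stdIdeal 𝕜 A S := by
    obtain ⟨n, hn⟩ := hv'
    exact ⟨n, Ideal.mul_mem_left _ _ hn⟩
  classical
  -- Take the least power of `v` carrying `x` into the ideal. It is positive, and cancelling `u`
  -- from `u * (x * v ^ n)` would lower it.
  obtain ⟨n, hn⟩ : ∃ n, Nat.find hex = n + 1 := Nat.exists_eq_succ_of_ne_zero fun h => hx (by
    have := Nat.find_spec hex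
    rwa [h, pow_zero, mul_one] at this)
  refine Nat.find_min hex (m := n) (by omega) (mem_stdIdeal_of_mul_mem hS hSF hu0 hu ?_)
  have h1 := Nat.find_spec hex
  rw [hn] at h1
  have h2 : u * (x * v ^ n) = (x * (u + v)) * v ^ n - x * v ^ (n + 1) := by ring
  rw [h2]
  exact sub_mem (Ideal.mul_mem_right _ _ hxy) h1

theorem injOn_facePrime : Set.InjOn (facePrime 𝕜 A) {F | IsFace A F} := by
  have key : ∀ F G : Finset (Fin d → ℤ), IsFace A F → IsFace A G →
      facePrime 𝕜 A F ≤ facePrime 𝕜 A G → G ⊆ F := by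
    intro F G hF hG h
    refine hG.subset_of_natSpan_le hF fun c hc => ?_
    by_contra hcF
    have h1 := h ((monomial_mem_stdIdeal hF.isDivisorClosed
      (b := ⟨c, hG.natSpan_le hc⟩)).2 hcF)
    rw [facePrime_eq, monomial_mem_stdIdeal hG.isDivisorClosed] at h1
    exact h1 hc
  intro F hF G hG h
  exact Finset.Subset.antisymm (key G F hG hF h.ge) (key F G hF hG h.le)

/-! ### The components and the intersection formula -/

open Pair

variable {I : Ideal (SemigroupRing 𝕜 A)} {F : Finset (Fin d → ℤ)}

theorem mem_componentStdMonomials {b : Fin d → ℤ} :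
    b ∈ componentStdMonomials I F ↔
      ∃ p : Pair A, IsMaximalStandardPair I p ∧ p.face = F ∧ b ∈ p.divisors :=
  ⟨fun ⟨hb, p, hp, hpF, h⟩ => ⟨p, hp, hpF, hb, h⟩,
    fun ⟨p, hp, hpF, hb, h⟩ => ⟨hb, p, hp, hpF, h⟩⟩

theorem isDivisorClosed_componentStdMonomials :
    IsDivisorClosed A (componentStdMonomials I F) := by
  intro b hb c hc h
  rw [mem_componentStdMonomials] at h ⊢
  obtain ⟨p, hp, hpF, h⟩ := h
  exact ⟨p, hp, hpF, mem_divisors_of_sub_mem hb h (by rwa [add_sub_cancel_left])⟩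

theorem component_eq : component I F = stdIdeal 𝕜 A (componentStdMonomials I F) := rfl

theorem monomial_mem_component {b : natSpan A} :
    monomial 𝕜 b ∈ component I F ↔ (b : Fin d → ℤ) ∉ componentStdMonomials I F :=
  monomial_mem_stdIdeal isDivisorClosed_componentStdMonomials

theorem isFace_of_mem_standardFaces (hF : F ∈ standardFaces I) : IsFace A F := by
  obtain ⟨p, -, rfl⟩ := hF
  exact p.isFace

theorem finite_standardFaces : (standardFaces I).Finite :=
  A.powerset.finite_toSet.subset fun _ hF =>
    Finset.mem_coe.2 (Finset.mem_powerset.2 (isFace_of_mem_standardFaces hF).subset)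

theorem exists_isMaximalStandardPair (hF : F ∈ standardFaces I) :
    ∃ p : Pair A, IsMaximalStandardPair I p ∧ p.face = F := by
  obtain ⟨p, hp, rfl⟩ := hF
  obtain ⟨q, hq, hqp, -⟩ := hp.exists_isMaximalStandardPair
  exact ⟨q, hq, hqp⟩

/-- There are finitely many divisor sets for `F`, and multiples of `c` leave each of them for good,
so a common exponent works. -/
theorem exists_nsmul_notMem_componentStdMonomials {c : Fin d → ℤ} (hc : c ∈ natSpan A)
    (hcF : c ∉ natSpan F) : ∃ n : ℕ, n • c ∉ componentStdMonomials I F := by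
  have hfin : (divisors '' {p : Pair A | IsMaximalStandardPair I p ∧ p.face = F}).Finite :=
    (finite_divisors_image I F).subset (Set.image_mono fun p hp => ⟨hp.1.1, hp.2⟩)
  have hn : ∀ D ∈ divisors '' {p : Pair A | IsMaximalStandardPair I p ∧ p.face = F},
      ∃ n : ℕ, n • c ∉ D := by
    rintro _ ⟨p, ⟨-, rfl⟩, rfl⟩
    exact p.exists_nsmul_notMem_divisors hc hcF
  choose! n hn using hn
  obtain ⟨N, hN⟩ := (hfin.image n).bddAbove
  refine ⟨N, fun h => ?_⟩
  obtain ⟨p, hp, hpF, h⟩ := mem_componentStdMonomials.1 h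
  have hpD : p.divisors ∈ divisors '' {p : Pair A | IsMaximalStandardPair I p ∧ p.face = F} :=
    ⟨p, ⟨hp, hpF⟩, rfl⟩
  refine hn _ hpD (mem_divisors_of_sub_mem (nsmul_mem hc _) h ?_)
  obtain ⟨k, hk⟩ := Nat.exists_eq_add_of_le (hN ⟨_, hpD, rfl⟩)
  rw [hk, add_smul, add_sub_cancel_left]
  exact nsmul_mem hc k

theorem isPrimaryTo_component (hF : F ∈ standardFaces I) :
    IsPrimaryTo (component I F) (facePrime 𝕜 A F) := by
  rw [component_eq]
  refine (isFace_of_mem_standardFaces hF).isPrimaryTo_stdIdeal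
    isDivisorClosed_componentStdMonomials ?_ ?_
    fun c hc hcF => exists_nsmul_notMem_componentStdMonomials hc hcF
  · obtain ⟨p, hp, hpF⟩ := exists_isMaximalStandardPair hF
    exact mem_componentStdMonomials.2 ⟨p, hp, hpF, mem_divisors_of_sub_mem (zero_mem _)
      (mem_divisors_of_mem_coset p.base_mem_coset) (by rw [sub_zero]; exact p.base_mem)⟩
  · intro b hb f hf
    obtain ⟨p, hp, rfl, hbp⟩ := mem_componentStdMonomials.1 hb
    exact mem_componentStdMonomials.2 ⟨p, hp, rfl, add_mem_divisors hbp hf⟩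

/-- Divisors of standard pairs are standard, so `I` lies in each component. Conversely, a standard
`b` gives the proper pair (b, ∅), which is contained in a standard pair and thus in the divisors of
a maximal one of the same face. -/
theorem eq_iInf_component (hA0 : (0 : Fin d → ℤ) ∉ A) (hA : IsStronglyConvex A)
    (hI : IsMonomialIdeal I) : I = ⨅ F ∈ standardFaces I, component I F := by
  have hdown := isDivisorClosed_stdMonomials I
  apply le_antisymm
  · refine le_iInf₂ fun F _ => ?_
    nth_rw 1 [hI.eq_stdIdeal]
    refine Ideal.span_mono (Set.image_mono fun b hb hbF => hb ?_)
    obtain ⟨p, hp, -, hbp⟩ := mem_componentStdMonomials.1 hbF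
    exact hp.1.1.divisors_subset hbp
  · intro x hx
    rw [hI.eq_stdIdeal, mem_stdIdeal hdown]
    intro b hb hbI
    let p : Pair A := ⟨b, b.2, ∅, hA.isFace_empty hA0⟩
    have hp : IsProperPair I p := by
      rintro _ ⟨f, hf, rfl⟩
      have hf0 : f = 0 := by simpa [p, natSpan] using hf
      rw [hf0, add_zero]
      exact hbI
    obtain ⟨q, hq, hpq⟩ := hp.exists_isStandardPair hA
    obtain ⟨r, hr, hrq, hqr⟩ := hq.exists_isMaximalStandardPair
    have hxr : x ∈ component I r.face :=
      (Submodule.mem_iInf _).1 ((Submodule.mem_iInf _).1 hx r.face) ⟨r, hr.1, rfl⟩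
    rw [component_eq, mem_stdIdeal isDivisorClosed_componentStdMonomials] at hxr
    exact hxr b hb (mem_componentStdMonomials.2 ⟨r, hr, rfl,
      hqr (mem_divisors_of_mem_coset (hpq p.base_mem_coset))⟩)

/-- Some element of `a + ℕF`, for a standard pair `(a, F)`, is nonstandard for every component
belonging to another face. -/
theorem IsStandardPair.exists_add_notMem_componentStdMonomials {p : Pair A} (hp : IsStandardPair I p) :
    ∃ f ∈ natSpan p.face, ∀ G ∈ standardFaces I, G ≠ p.face →
      p.base + f ∉ componentStdMonomials I G := by
  have hn : ∀ c ∈ p.face, ∀ G ∈ standardFaces I, ∃ n : ℕ, c ∉ G →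
      n • c ∉ componentStdMonomials I G := by
    intro c hc G hG
    by_cases hcG : c ∈ G
    · exact ⟨0, fun h => absurd hcG h⟩
    · obtain ⟨n, hn⟩ := exists_nsmul_notMem_componentStdMonomials (I := I)
        (AddSubmonoid.subset_closure (p.isFace.subset hc))
        fun h => hcG ((isFace_of_mem_standardFaces hG).mem_of_mem_natSpan (p.isFace.subset hc) h)
      exact ⟨n, fun _ => hn⟩
  choose! n hn using hn
  obtain ⟨N, hN⟩ : BddAbove ((fun q : (Fin d → ℤ) × Finset (Fin d → ℤ) => n q.1 q.2) ''
      ((p.face : Set (Fin d → ℤ)) ×ˢ standardFaces I)) :=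
    ((p.face.finite_toSet.prod finite_standardFaces).image _).bddAbove
  have hsum : ∀ s ⊆ p.face, N • ∑ c ∈ s, c ∈ natSpan p.face := fun s hs =>
    nsmul_mem (sum_mem fun c hc => AddSubmonoid.subset_closure (hs hc)) N
  -- If `G` contains the face of `p`, the base of `p` would divide into a standard pair of the
  -- larger face `G`. Otherwise some `c` in the face lies outside `G`, and `N` is large enough for
  -- `N • c` to leave the component.
  refine ⟨N • ∑ c ∈ p.face, c, hsum _ subset_rfl, fun G hG hGp hmem => ?_⟩
  by_cases hpG : p.face ⊆ G
  · obtain ⟨q, hq, rfl, hpq⟩ := mem_componentStdMonomials.1 hmem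
    refine hGp (hp.face_eq_of_mem_divisors hq.1.1 hpG ?_)
    refine mem_divisors_of_sub_mem p.base_mem hpq ?_
    rw [add_sub_cancel_left]
    exact p.isFace.natSpan_le (hsum _ subset_rfl)
  · obtain ⟨c, hc, hcG⟩ := Finset.not_subset.1 hpG
    have hcA : c ∈ natSpan A := AddSubmonoid.subset_closure (p.isFace.subset hc)
    obtain ⟨k, hk⟩ := Nat.exists_eq_add_of_le (hN ⟨(c, G), ⟨hc, hG⟩, rfl⟩)
    classical
    refine hn c hc G hG hcG (isDivisorClosed_componentStdMonomials _ (nsmul_mem hcA _)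
      (p.base + k • c + N • ∑ c ∈ p.face.erase c, c) ?_ ?_)
    · exact add_mem (add_mem p.base_mem (nsmul_mem hcA k))
        (p.isFace.natSpan_le (hsum _ (Finset.erase_subset _ _)))
    · have hNc : N • c = n c G • c + k • c := by rw [hk, add_smul]
      convert hmem using 1
      rw [← Finset.add_sum_erase _ _ hc, smul_add, hNc]
      abel

/-- The prime of a face with a standard pair is the annihilator of a standard monomial. -/
theorem exists_monomial_colon (hI : I = ⨅ F ∈ standardFaces I, component I F)
    (hF : F ∈ standardFaces I) : ∃ m : natSpan A, monomial 𝕜 m ∉ I ∧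
      (∀ G ∈ standardFaces I, G ≠ F → monomial 𝕜 m ∈ component I G) ∧
      ∀ y, y * monomial 𝕜 m ∈ I ↔ y ∈ facePrime 𝕜 A F := by
  obtain ⟨p, hp, rfl⟩ := exists_isMaximalStandardPair hF
  obtain ⟨f, hf, hfG⟩ := hp.1.exists_add_notMem_componentStdMonomials
  -- As t^m lies in all other components, (I : t^m) = (C_F : t^m), and C_F being primary puts this
  -- inside 𝔭_F.
  let m : natSpan A := ⟨p.base + f, p.coset_subset (p.add_mem_coset hf)⟩
  have hmp : (m : Fin d → ℤ) ∈ p.divisors := mem_divisors_of_mem_coset (p.add_mem_coset hf)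
  have hmG : ∀ G ∈ standardFaces I, G ≠ p.face → monomial 𝕜 m ∈ component I G :=
    fun G hG hGp => monomial_mem_component.2 (hfG G hG hGp)
  have hmC : monomial 𝕜 m ∉ component I p.face := fun h =>
    monomial_mem_component.1 h (mem_componentStdMonomials.2 ⟨p, hp, rfl, hmp⟩)
  have hmem : ∀ y, y * monomial 𝕜 m ∈ I ↔ y * monomial 𝕜 m ∈ component I p.face := by
    intro y
    nth_rw 1 [hI]
    simp only [Submodule.mem_iInf]
    refine ⟨fun h => h _ hF, fun h G hG => ?_⟩
    by_cases hGp : G = p.face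
    · rwa [hGp]
    · exact Ideal.mul_mem_left _ _ (hmG G hG hGp)
  have hprim := isPrimaryTo_component hF
  refine ⟨m, fun h => hmC ?_, hmG, fun y => ⟨fun h => ?_, fun h => (hmem y).2 ?_⟩⟩
  · have := (hmem 1).1 (by rwa [one_mul])
    rwa [one_mul] at this
  · have h1 := (hmem y).1 h
    rw [mul_comm] at h1
    rw [← hprim.2]
    exact ((Ideal.isPrimary_iff.1 hprim.1).2 h1).resolve_left hmC
  · have hle : facePrime 𝕜 A p.face ≤ (component I p.face).colon {monomial 𝕜 m} := by
      rw [facePrime, Ideal.span_le]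
      rintro _ ⟨c, hc, rfl⟩
      rw [SetLike.mem_coe, Submodule.mem_colon_singleton, smul_eq_mul, monomial_mul,
        monomial_mem_component]
      intro hcm
      obtain ⟨q, hq, hqp, hcq⟩ := mem_componentStdMonomials.1 hcm
      have hpq : p.base ∈ q.divisors := by
        refine mem_divisors_of_sub_mem p.base_mem hcq ?_
        have : ((c + m : natSpan A) : Fin d → ℤ) - p.base = c + f := by
          simp only [AddSubmonoid.coe_add, m]
          abel
        rw [this]
        exact add_mem c.2 (p.isFace.natSpan_le hf)
      -- Maximality of the overlap class of `p` enters here: `q` overlaps `p`, so c + m divides some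
      -- `p.base + g` with g ∈ ℕF. As m = `p.base` + f, `c` is a summand of g, hence in ℕF.
      have hov := hp.2 q hq.1 ((divides_iff hqp.superset).2 hpq)
      obtain ⟨-, _, ⟨g, hg, rfl⟩, h'⟩ := hov.divisors_subset hcq
      have h2 : (c : Fin d → ℤ) + (p.base + g - ((c + m : natSpan A) : Fin d → ℤ) + f) = g := by
        simp only [AddSubmonoid.coe_add, m]
        abel
      exact hc (p.isFace.mem_of_add_mem c.2 (add_mem h' (p.isFace.natSpan_le hf))
        (by rwa [h2]))
    have := hle h
    rwa [Submodule.mem_colon_singleton, smul_eq_mul] at this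

/-! ### Associated primes -/

theorem mem_colon_bot_mk {x y : SemigroupRing 𝕜 A} :
    y ∈ (⊥ : Submodule (SemigroupRing 𝕜 A) (SemigroupRing 𝕜 A ⧸ I)).colon
      {Ideal.Quotient.mk I x} ↔ y * x ∈ I := by
  rw [Submodule.mem_colon_singleton, Submodule.mem_bot, ← Ideal.Quotient.eq_zero_iff_mem]
  rfl

theorem facePrime_mem_associatedPrimes (hI : I = ⨅ F ∈ standardFaces I, component I F)
    (hF : F ∈ standardFaces I) :
    facePrime 𝕜 A F ∈ associatedPrimes (SemigroupRing 𝕜 A) (SemigroupRing 𝕜 A ⧸ I) := by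
  obtain ⟨m, -, -, hm⟩ := exists_monomial_colon hI hF
  have hprime := (isFace_of_mem_standardFaces hF).isPrime_facePrime (𝕜 := 𝕜)
  refine ⟨hprime, Ideal.Quotient.mk I (monomial 𝕜 m), ?_⟩
  have : (⊥ : Submodule (SemigroupRing 𝕜 A) (SemigroupRing 𝕜 A ⧸ I)).colon
      {Ideal.Quotient.mk I (monomial 𝕜 m)} = facePrime 𝕜 A F := by
    ext y
    rw [mem_colon_bot_mk, hm]
  -- An associated prime is here the radical of an annihilator, and a prime annihilator is its own
  -- radical.
  rw [this, hprime.radical]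

/-- The annihilator of x modulo `I` is the finite intersection of the (C_G : x), so the prime 𝔭_F
contains one of them. Then x ∉ C_G, and C_G ⊆ (C_G : x) ⊆ 𝔭_G; taking radicals gives 𝔭_F = 𝔭_G. -/
theorem mem_standardFaces_of_mem_associatedPrimes
    (hI : I = ⨅ F ∈ standardFaces I, component I F) (hF : IsFace A F)
    (h : facePrime 𝕜 A F ∈ associatedPrimes (SemigroupRing 𝕜 A) (SemigroupRing 𝕜 A ⧸ I)) :
    F ∈ standardFaces I := by
  obtain ⟨hprime, x, hx⟩ := h
  obtain ⟨x, rfl⟩ := Ideal.Quotient.mk_surjective x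
  have hcolon : (⊥ : Submodule (SemigroupRing 𝕜 A) (SemigroupRing 𝕜 A ⧸ I)).colon
      {Ideal.Quotient.mk I x} =
      (finite_standardFaces (I := I)).toFinset.inf fun G => (component I G).colon {x} := by
    ext y
    rw [mem_colon_bot_mk]
    nth_rw 1 [hI]
    simp only [Submodule.mem_iInf, Submodule.mem_finsetInf, Set.Finite.mem_toFinset,
      Submodule.mem_colon_singleton, smul_eq_mul]
  obtain ⟨G, hG, hGle⟩ := hprime.inf_le'.1 (hcolon ▸ Ideal.le_radical.trans hx.ge)
  rw [Set.Finite.mem_toFinset] at hG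
  have hprim := isPrimaryTo_component hG
  have hxG : x ∉ component I G := fun h => hprime.ne_top
    (top_le_iff.1 (((Submodule.colon_eq_top_iff_subset _).2
      (Set.singleton_subset_iff.2 h)).ge.trans hGle))
  have hle : (component I G).colon {x} ≤ facePrime 𝕜 A G := by
    intro y (hy : y ∈ (component I G).colon {x})
    rw [Submodule.mem_colon_singleton, smul_eq_mul, mul_comm] at hy
    rw [← hprim.2]
    exact ((Ideal.isPrimary_iff.1 hprim.1).2 hy).resolve_left hxG
  have h1 : facePrime 𝕜 A F ≤ facePrime 𝕜 A G := by
    rw [hx, hcolon,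
      ((isFace_of_mem_standardFaces hG).isPrime_facePrime (𝕜 := 𝕜)).radical_le_iff]
    exact (Finset.inf_le (by rwa [Set.Finite.mem_toFinset])).trans hle
  have h2 : facePrime 𝕜 A G ≤ facePrime 𝕜 A F := by
    rw [← hprim.2, hprime.radical_le_iff]
    exact Ideal.le_colon.trans hGle
  rwa [injOn_facePrime (𝕜 := 𝕜) hF (isFace_of_mem_standardFaces hG) (le_antisymm h1 h2)]

end AffineSemigroup

end

/-! ### The decomposition theorem and its consequences -/

theorem mainTheorem2 {𝕜 : Type*} [Field 𝕜] [Infinite 𝕜] {d : ℕ}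
    (A : Finset (Fin d → ℤ)) (hA0 : (0 : Fin d → ℤ) ∉ A) (hA : IsStronglyConvex A)
    (I : Ideal (SemigroupRing 𝕜 A)) (hI : IsMonomialIdeal I) :
    -- each `C_F` is the monomial ideal with the prescribed standard monomials, and is primary
    (∀ F ∈ standardFaces I,
      IsMonomialIdeal (component I F) ∧
      stdMonomials (component I F) = componentStdMonomials I F ∧
      IsPrimaryTo (component I F) (facePrime 𝕜 A F)) ∧
    -- `I` is the intersection of the `C_F`, irredundantly and with distinct primes
    (standardFaces I).Finite ∧
    I = ⨅ F ∈ standardFaces I, component I F ∧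
    (∀ F ∈ standardFaces I, I ≠ ⨅ G ∈ standardFaces I \ {F}, component I G) ∧
    Set.InjOn (facePrime 𝕜 A) (standardFaces I) ∧
    -- the consequences
    (∀ F, IsFace A F →
      (facePrime 𝕜 A F ∈ associatedPrimes (SemigroupRing 𝕜 A) (SemigroupRing 𝕜 A ⧸ I) ↔
        ∃ p : Pair A, IsStandardPair I p ∧ p.face = F)) ∧
    (∀ F, IsFace A F → I ≠ ⊤ →
      (IsPrimaryTo I (facePrime 𝕜 A F) ↔
        ∀ p : Pair A, IsStandardPair I p → p.face = F)) := by
  have hinf := eq_iInf_component hA0 hA hI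
  refine ⟨fun F hF => ⟨⟨_, rfl⟩, stdMonomials_stdIdeal isDivisorClosed_componentStdMonomials
    fun b hb => hb.1, isPrimaryTo_component hF⟩, finite_standardFaces, hinf, fun F hF h => ?_,
    injOn_facePrime.mono fun F hF => isFace_of_mem_standardFaces hF,
    fun F hF => ⟨mem_standardFaces_of_mem_associatedPrimes hinf hF,
      facePrime_mem_associatedPrimes hinf⟩, fun F hF hne => ⟨fun hprim p hp => ?_, fun h => ?_⟩⟩
  -- This t^m lies in every component but C_F and not in `I`, so C_F cannot be omitted.
  · obtain ⟨m, hm, hmG, -⟩ := exists_monomial_colon hinf hF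
    rw [h] at hm
    simp only [Submodule.mem_iInf] at hm
    exact hm fun G hG => hmG G hG.1 hG.2
  -- With G the face of `p` and (I : t^m) = 𝔭_G, t^m ∉ I: primariness gives 𝔭_G ⊆ 𝔭_F, and I ⊆ (I :
  -- t^m) gives 𝔭_F ⊆ 𝔭_G.
  · have hpI : p.face ∈ standardFaces I := ⟨p, hp, rfl⟩
    obtain ⟨m, hm, -, hcolon⟩ := exists_monomial_colon hinf hpI
    refine injOn_facePrime (𝕜 := 𝕜) p.isFace hF (le_antisymm (fun y hy => ?_) ?_)
    · have h1 := (hcolon y).2 hy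
      rw [mul_comm] at h1
      rw [← hprim.2]
      exact ((Ideal.isPrimary_iff.1 hprim.1).2 h1).resolve_left hm
    · rw [← hprim.2, p.isFace.isPrime_facePrime.radical_le_iff]
      exact fun y hy => (hcolon y).1 (Ideal.mul_mem_right _ _ hy)
  · have hsub : standardFaces I ⊆ {F} := by
      rintro _ ⟨p, hp, rfl⟩
      exact h p hp
    -- With no standard faces the empty intersection would make `I` the whole ring; otherwise C_F is
    -- the only component.
    rcases Set.subset_singleton_iff_eq.1 hsub with h0 | h1
    · rw [h0] at hinf
      exact absurd (hinf.trans (by simp)) hne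
    · have hFI : F ∈ standardFaces I := h1 ▸ Set.mem_singleton F
      have hIF : I = component I F := by
        nth_rw 1 [hinf]
        rw [h1]
        simp
      rw [hIF]
      exact isPrimaryTo_component hFI
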